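/- Let $F:\mathbb{R}\to\mathbb{R}$ be locally Lipschitz, and suppose that $F$ is linear (i.e. affine, $F(p)=\alpha p+\beta$ for some $\alpha,\beta\in\mathbb{R}$) on an interval $(a,b)$, where $a<b$. Then there exist a Lipschitz function $g:\mathbb{R}\to\mathbb{R}$ and a constant $c_0>0$ such that for every $\varepsilon\in(0,\tfrac14)$ $$|u^\varepsilon(0,1)-u(0,1)|\ \ge\ c_0\sqrt{\varepsilon},$$ where $u^\varepsilon$ and $u$ denote the viscosity solutions in $C(\mathbb{R}\times[0,\infty))$ of $$u^\varepsilon_t+F(u^\varepsilon_x)=\varepsilon u^\varepsilon_{xx}\ \text{ in }\mathbb{R}\times(0,\infty),\qquad u^\varepsilon(\cdot,0)=g \ \text{ on }\mathbb{R},$$ and $$u_t+F(u_x)=0\ \text{ in }\mathbb{R}\times(0,\infty),\qquad u(\cdot,0)=g\ \text{ on }\mathbb{R},$$ respectively; here each of these problems has exactly one viscosity solution with at most linear growth in $x$ uniformly on bounded time intervals (that is, for every $T>0$ there is $C$ with $|u(x,t)|\le C(1+|x|)$ on $\mathbb{R}\times[0,T]$), and this is the solution meant. -/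

import Mathlib

open Set Function

/-- `u` is a viscosity subsolution of `u_t + F(u_x) = ε u_xx` in `ℝ × (0,∞)`: whenever
`u - φ` has a local maximum at `(x₀,t₀)`, `t₀ > 0`, for a test function `φ ∈ C²(ℝ × (0,∞))`,
one has `φ_t + F(φ_x) ≤ ε φ_xx` there. The first argument of `u` and `φ` is the space
variable, the second one is time. The first-order equation is the case `ε = 0`. -/
def IsViscositySubsolution (F : ℝ → ℝ) (ε : ℝ) (u : ℝ → ℝ → ℝ) : Prop :=
  ∀ φ : ℝ → ℝ → ℝ, ContDiffOn ℝ 2 (uncurry φ) (univ ×ˢ Ioi 0) →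
    ∀ x₀ t₀ : ℝ, 0 < t₀ →
      IsLocalMax (fun z : ℝ × ℝ => u z.1 z.2 - φ z.1 z.2) (x₀, t₀) →
      deriv (fun t => φ x₀ t) t₀ + F (deriv (fun x => φ x t₀) x₀)
        ≤ ε * iteratedDeriv 2 (fun x => φ x t₀) x₀

/-- `u` is a viscosity supersolution of `u_t + F(u_x) = ε u_xx` in `ℝ × (0,∞)`. -/
def IsViscositySupersolution (F : ℝ → ℝ) (ε : ℝ) (u : ℝ → ℝ → ℝ) : Prop :=
  ∀ φ : ℝ → ℝ → ℝ, ContDiffOn ℝ 2 (uncurry φ) (univ ×ˢ Ioi 0) →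
    ∀ x₀ t₀ : ℝ, 0 < t₀ →
      IsLocalMin (fun z : ℝ × ℝ => u z.1 z.2 - φ z.1 z.2) (x₀, t₀) →
      ε * iteratedDeriv 2 (fun x => φ x t₀) x₀
        ≤ deriv (fun t => φ x₀ t) t₀ + F (deriv (fun x => φ x t₀) x₀)

/-- `u ∈ C(ℝ × [0,∞))` is a viscosity solution of the Cauchy problem
`u_t + F(u_x) = ε u_xx` in `ℝ × (0,∞)`, `u(·,0) = g` on `ℝ`, in the usual class for Lipschitz
initial data: at most linear growth in `x`, uniformly on bounded time intervals. Only the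
values of `u` at times `t ≥ 0` matter. -/
structure IsViscositySolution (F g : ℝ → ℝ) (ε : ℝ) (u : ℝ → ℝ → ℝ) : Prop where
  continuousOn : ContinuousOn (uncurry u) (univ ×ˢ Ici 0)
  linear_growth : ∀ T : ℝ, ∃ C : ℝ, ∀ x : ℝ, ∀ t ∈ Icc 0 T, |u x t| ≤ C * (1 + |x|)
  initial : ∀ x : ℝ, u x 0 = g x
  subsolution : IsViscositySubsolution F ε u
  supersolution : IsViscositySupersolution F ε u

/-- `u` is *the* viscosity solution of the Cauchy problem: it is a viscosity solution, and every
viscosity solution coincides with it on `ℝ × [0,∞)`. -/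
def IsTheViscositySolution (F g : ℝ → ℝ) (ε : ℝ) (u : ℝ → ℝ → ℝ) : Prop :=
  IsViscositySolution F g ε u ∧
    ∀ v : ℝ → ℝ → ℝ, IsViscositySolution F g ε v → ∀ x t : ℝ, 0 ≤ t → v x t = u x t

/-! The datum is a kink `p x + d |x + α|` whose slopes stay in the interval where `F` has slope `α`.
On such slopes the equation is transport with speed `α` plus diffusion. The inviscid solution is
therefore the rigidly transported kink, and the viscous one is the same kink convolved with a
Gaussian of scale `√(4 ε t)`. The shift by `α` brings the apex to `x = 0` at time `1`. There the
convolution lifts `|y|` from `0` to scale divided by `√π`, so the gap is exactly `2 d √ε / √π`.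

Since the slopes never leave `[p - d, p + d]`, both functions solve the equation with the true `F`.
It remains to show that they are the unique viscosity solutions of linear growth. All comparison is
made against classical functions (`IsViscositySubsolution.le_of_classical`): the classical function
plus a barrier is itself a test function, so no doubling of variables is needed.

The viscous kink is classical for `t > 0`. The sharp kink is not, but it lies within `d κ` of the
kink mollified at a fixed scale `κ`, which is a classical solution of the first-order equation.
Comparing with these and letting `κ → 0` gives uniqueness. -/

open Filter Topology

/-! ### Classical functions as viscosity sub- and supersolutions -/

/-- `U` is `C²` on `ℝ × (0,∞)` with time derivative `Ut`, space derivative `Ux` and second space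
derivative `Uxx`. -/
structure HasParabolicDeriv (U Ut Ux Uxx : ℝ → ℝ → ℝ) : Prop where
  contDiffOn : ContDiffOn ℝ 2 (uncurry U) (univ ×ˢ Ioi 0)
  time : ∀ x t : ℝ, 0 < t → HasDerivAt (fun s => U x s) (Ut x t) t
  space : ∀ x t : ℝ, 0 < t → HasDerivAt (fun y => U y t) (Ux x t) x
  space_space : ∀ x t : ℝ, 0 < t → HasDerivAt (fun y => Ux y t) (Uxx x t) x

namespace HasParabolicDeriv

variable {U Ut Ux Uxx V Vt Vx Vxx : ℝ → ℝ → ℝ}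

theorem add (hU : HasParabolicDeriv U Ut Ux Uxx) (hV : HasParabolicDeriv V Vt Vx Vxx) :
    HasParabolicDeriv (fun x t => U x t + V x t) (fun x t => Ut x t + Vt x t)
      (fun x t => Ux x t + Vx x t) (fun x t => Uxx x t + Vxx x t) where
  contDiffOn := hU.contDiffOn.add hV.contDiffOn
  time x t ht := (hU.time x t ht).add (hV.time x t ht)
  space x t ht := (hU.space x t ht).add (hV.space x t ht)
  space_space x t ht := (hU.space_space x t ht).add (hV.space_space x t ht)

theorem neg (hU : HasParabolicDeriv U Ut Ux Uxx) :
    HasParabolicDeriv (fun x t => -U x t) (fun x t => -Ut x t)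
      (fun x t => -Ux x t) (fun x t => -Uxx x t) where
  contDiffOn := hU.contDiffOn.neg
  time x t ht := (hU.time x t ht).neg
  space x t ht := (hU.space x t ht).neg
  space_space x t ht := (hU.space_space x t ht).neg

theorem add_const (hU : HasParabolicDeriv U Ut Ux Uxx) (c : ℝ) :
    HasParabolicDeriv (fun x t => U x t + c) Ut Ux Uxx where
  contDiffOn := hU.contDiffOn.add contDiffOn_const
  time x t ht := (hU.time x t ht).add_const c
  space x t ht := (hU.space x t ht).add_const c
  space_space := hU.space_space

theorem iteratedDeriv_two (hU : HasParabolicDeriv U Ut Ux Uxx) (x : ℝ) {t : ℝ} (ht : 0 < t) :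
    iteratedDeriv 2 (fun y => U y t) x = Uxx x t := by
  have h : deriv (fun y => U y t) = fun y => Ux y t := funext fun y => (hU.space y t ht).deriv
  rw [iteratedDeriv_succ, iteratedDeriv_one, h, (hU.space_space x t ht).deriv]

end HasParabolicDeriv

theorem contDiff_slice_space {φ : ℝ → ℝ → ℝ}
    (hφ : ContDiffOn ℝ 2 (uncurry φ) (univ ×ˢ Ioi 0)) {t : ℝ} (ht : 0 < t) :
    ContDiff ℝ 2 (fun x => φ x t) := by
  have h : ContDiff ℝ 2 (fun x : ℝ => (x, t)) := contDiff_id.prodMk contDiff_const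
  exact contDiffOn_univ.1 (hφ.comp (s := univ) h.contDiffOn fun x _ => ⟨mem_univ _, ht⟩)

theorem differentiableAt_slice_time {φ : ℝ → ℝ → ℝ}
    (hφ : ContDiffOn ℝ 2 (uncurry φ) (univ ×ˢ Ioi 0)) (x : ℝ) {t : ℝ} (ht : 0 < t) :
    DifferentiableAt ℝ (fun s => φ x s) t := by
  have h : ContDiff ℝ 2 (fun s : ℝ => (x, s)) := contDiff_const.prodMk contDiff_id
  exact ((hφ.comp (s := Ioi 0) h.contDiffOn fun s hs => ⟨mem_univ _, hs⟩).differentiableOn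
    two_ne_zero).differentiableAt (Ioi_mem_nhds ht)

/-- If the second derivative were positive, the point would also be a local minimum, so `f` would be
locally constant and its second derivative zero. -/
theorem IsLocalMax.deriv_deriv_nonpos {f : ℝ → ℝ} {x : ℝ} (h : IsLocalMax f x)
    (hf : ContinuousAt f x) : deriv (deriv f) x ≤ 0 := by
  by_contra! hpos
  have hmin := isLocalMin_of_deriv_deriv_pos hpos h.deriv_eq_zero hf
  have heq : f =ᶠ[𝓝 x] fun _ => f x := by
    filter_upwards [h, hmin] with y h₁ h₂ using le_antisymm h₁ h₂
  have h0 : deriv (deriv f) x = 0 := by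
    have := heq.deriv.deriv_eq
    simpa using this
  exact hpos.ne' h0

theorem IsLocalMax.slice_space {f : ℝ × ℝ → ℝ} {x t : ℝ} (h : IsLocalMax f (x, t)) :
    IsLocalMax (fun y => f (y, t)) x :=
  (h.comp_tendsto (g := fun y : ℝ => (y, t)) (by
    have : Continuous fun y : ℝ => (y, t) := by fun_prop
    exact this.tendsto x))

theorem IsLocalMax.slice_time {f : ℝ × ℝ → ℝ} {x t : ℝ} (h : IsLocalMax f (x, t)) :
    IsLocalMax (fun s => f (x, s)) t :=
  (h.comp_tendsto (g := fun s : ℝ => (x, s)) (by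
    have : Continuous fun s : ℝ => (x, s) := by fun_prop
    exact this.tendsto t))

/-- At a maximum of `U - φ` the first derivatives agree and `Uxx ≤ φ_xx`; since `0 ≤ ε`, the
pointwise inequality passes from `U` to `φ`. -/
theorem HasParabolicDeriv.isViscositySubsolution {F : ℝ → ℝ} {ε : ℝ} {U Ut Ux Uxx : ℝ → ℝ → ℝ}
    (hU : HasParabolicDeriv U Ut Ux Uxx) (hε : 0 ≤ ε)
    (h : ∀ x t, 0 < t → Ut x t + F (Ux x t) ≤ ε * Uxx x t) : IsViscositySubsolution F ε U := by
  intro φ hφ x t ht hmax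
  have hφt := differentiableAt_slice_time hφ x ht
  have hφx := contDiff_slice_space hφ ht
  have hdx : Differentiable ℝ fun y => φ y t := hφx.differentiable two_ne_zero
  have e₁ : deriv (fun s => φ x s) t = Ut x t := by
    have := hmax.slice_time.hasDerivAt_eq_zero ((hU.time x t ht).sub hφt.hasDerivAt)
    linarith
  have e₂ : deriv (fun y => φ y t) x = Ux x t := by
    have := hmax.slice_space.hasDerivAt_eq_zero ((hU.space x t ht).sub (hdx x).hasDerivAt)
    linarith
  have hd : deriv (fun y => U y t - φ y t) = fun y => Ux y t - deriv (fun y => φ y t) y :=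
    funext fun y => ((hU.space y t ht).sub (hdx y).hasDerivAt).deriv
  have hdd : Differentiable ℝ (deriv fun y => φ y t) :=
    ((contDiff_succ_iff_deriv (n := 1)).1 hφx).2.2.differentiable one_ne_zero
  have e₃ := hmax.slice_space.deriv_deriv_nonpos
    ((hU.space x t ht).sub (hdx x).hasDerivAt).continuousAt
  change deriv (deriv fun y => U y t - φ y t) x ≤ 0 at e₃
  rw [hd, ((hU.space_space x t ht).fun_sub (hdd x).hasDerivAt).deriv] at e₃
  rw [iteratedDeriv_succ, iteratedDeriv_one, e₁, e₂]
  have := mul_le_mul_of_nonneg_left (sub_nonpos.1 e₃) hε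
  linarith [h x t ht]

/-- Reflection `u ↦ -u` exchanges sub- and supersolutions, for the reflected nonlinearity. -/
theorem IsViscositySupersolution.neg {F : ℝ → ℝ} {ε : ℝ} {u : ℝ → ℝ → ℝ}
    (h : IsViscositySupersolution F ε u) :
    IsViscositySubsolution (fun p => -F (-p)) ε (fun x t => -u x t) := by
  intro φ hφ x t ht hmax
  have hmin : IsLocalMin (fun z : ℝ × ℝ => u z.1 z.2 - (fun x t => -φ x t) z.1 z.2) (x, t) := by
    have e : (fun z : ℝ × ℝ => u z.1 z.2 - (fun x t => -φ x t) z.1 z.2) =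
        fun z => -(-u z.1 z.2 - φ z.1 z.2) := funext fun z => by ring
    rw [e]
    exact hmax.neg
  have := h (fun x t => -φ x t) hφ.neg x t ht hmin
  rw [deriv.fun_neg, deriv.fun_neg, iteratedDeriv_fun_neg] at this
  linarith

theorem IsViscositySubsolution.neg {F : ℝ → ℝ} {ε : ℝ} {u : ℝ → ℝ → ℝ}
    (h : IsViscositySubsolution F ε u) :
    IsViscositySupersolution (fun p => -F (-p)) ε (fun x t => -u x t) := by
  intro φ hφ x t ht hmin
  have hmax : IsLocalMax (fun z : ℝ × ℝ => u z.1 z.2 - (fun x t => -φ x t) z.1 z.2) (x, t) := by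
    have e : (fun z : ℝ × ℝ => u z.1 z.2 - (fun x t => -φ x t) z.1 z.2) =
        fun z => -(-u z.1 z.2 - φ z.1 z.2) := funext fun z => by ring
    rw [e]
    exact hmin.neg
  have := h (fun x t => -φ x t) hφ.neg x t ht hmax
  rw [deriv.fun_neg, deriv.fun_neg, iteratedDeriv_fun_neg] at this
  linarith

theorem HasParabolicDeriv.isViscositySupersolution {F : ℝ → ℝ} {ε : ℝ}
    {U Ut Ux Uxx : ℝ → ℝ → ℝ} (hU : HasParabolicDeriv U Ut Ux Uxx) (hε : 0 ≤ ε)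
    (h : ∀ x t, 0 < t → ε * Uxx x t ≤ Ut x t + F (Ux x t)) : IsViscositySupersolution F ε U := by
  have := (hU.neg.isViscositySubsolution (F := fun p => -F (-p)) hε fun x t ht => by
    have := h x t ht
    rw [neg_neg]
    linarith).neg
  simpa using this

/-! ### The barrier at spatial infinity -/

/-- A positive function of slope at most `M`, growing like `M * |x|`, and tending to `0` pointwise
as `k → 0`. It dominates linear growth and moves with finite speed. -/
noncomputable def coshBarrier (M k L x t : ℝ) : ℝ :=
  M * Real.log (1 + k * Real.exp (L * t) * Real.cosh x)

section coshBarrier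

variable {M k L : ℝ}

theorem one_add_mul_exp_mul_cosh_pos (hk : 0 < k) (x t : ℝ) :
    0 < 1 + k * Real.exp (L * t) * Real.cosh x := by
  have := Real.cosh_pos x
  positivity

theorem coshBarrier_pos (hM : 0 < M) (hk : 0 < k) (x t : ℝ) : 0 < coshBarrier M k L x t := by
  have := Real.cosh_pos x
  exact mul_pos hM (Real.log_pos (lt_add_of_pos_right _ (by positivity)))

theorem contDiff_coshBarrier (hk : 0 < k) : ContDiff ℝ 2 (uncurry (coshBarrier M k L)) := by
  have h : ContDiff ℝ 2 fun z : ℝ × ℝ => 1 + k * Real.exp (L * z.2) * Real.cosh z.1 := by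
    have := Real.contDiff_cosh (n := 2)
    fun_prop
  exact contDiff_const.mul (h.log fun z => (one_add_mul_exp_mul_cosh_pos hk z.1 z.2).ne')

theorem hasParabolicDeriv_coshBarrier (hk : 0 < k) :
    HasParabolicDeriv (coshBarrier M k L)
      (fun x t => M * (k * (Real.exp (L * t) * L) * Real.cosh x /
        (1 + k * Real.exp (L * t) * Real.cosh x)))
      (fun x t => M * (k * Real.exp (L * t) * Real.sinh x /
        (1 + k * Real.exp (L * t) * Real.cosh x)))
      (fun x t => M * ((k * Real.exp (L * t) * Real.cosh x *
        (1 + k * Real.exp (L * t) * Real.cosh x) - k * Real.exp (L * t) * Real.sinh x *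
          (k * Real.exp (L * t) * Real.sinh x)) /
        (1 + k * Real.exp (L * t) * Real.cosh x) ^ 2)) where
  contDiffOn := (contDiff_coshBarrier hk).contDiffOn
  time x t _ := by
    have h : HasDerivAt (fun s => 1 + k * Real.exp (L * s) * Real.cosh x)
        (k * (Real.exp (L * t) * L) * Real.cosh x) t := by
      have := (((hasDerivAt_id t).const_mul L).exp.const_mul k).mul_const (Real.cosh x)
      simpa using this.const_add 1
    exact (h.log (one_add_mul_exp_mul_cosh_pos hk x t).ne').const_mul M
  space x t _ :=
    ((((Real.hasDerivAt_cosh x).const_mul _).const_add 1).log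
      (one_add_mul_exp_mul_cosh_pos hk x t).ne').const_mul M
  space_space x t _ :=
    (((Real.hasDerivAt_sinh x).const_mul _).div
      (((Real.hasDerivAt_cosh x).const_mul _).const_add 1)
      (one_add_mul_exp_mul_cosh_pos hk x t).ne').const_mul M

/-- Follows from `cosh x ≥ exp |x| / 2`. Growth at rate `M` lets the barrier absorb any linear
growth of smaller rate. -/
theorem le_coshBarrier (hM : 0 ≤ M) (hk : 0 < k) (hL : 0 ≤ L) (x : ℝ) {t : ℝ} (ht : 0 ≤ t) :
    M * (|x| + Real.log (k / 2)) ≤ coshBarrier M k L x t := by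
  refine mul_le_mul_of_nonneg_left ?_ hM
  rw [← Real.log_exp |x|, ← Real.log_mul (Real.exp_pos _).ne' (by positivity)]
  refine Real.log_le_log (by positivity) ?_
  have h₁ : Real.exp |x| / 2 ≤ Real.cosh x := by
    rw [Real.cosh_eq]
    linarith [Real.exp_abs_le x]
  have h₂ : 1 ≤ Real.exp (L * t) := Real.one_le_exp (by positivity)
  have h₃ : k * 1 * (Real.exp |x| / 2) ≤ k * Real.exp (L * t) * Real.cosh x := by gcongr
  linarith

theorem tendsto_coshBarrier (x t : ℝ) :
    Tendsto (fun k => coshBarrier M k L x t) (𝓝[>] 0) (𝓝 0) := by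
  have h : ContinuousAt (fun k => coshBarrier M k L x t) 0 := by
    unfold coshBarrier
    refine continuousAt_const.mul (ContinuousAt.log (by fun_prop) (by simp))
  have := h.tendsto.mono_left (nhdsWithin_le_nhds (s := Ioi 0))
  simpa [coshBarrier] using this

end coshBarrier

/-! ### Comparison with classical solutions -/

theorem LocallyLipschitz.exists_abs_sub_le {F : ℝ → ℝ} (hF : LocallyLipschitz F) (R : ℝ) :
    ∃ K : ℝ, 0 ≤ K ∧ ∀ p q : ℝ, |p| ≤ R → |q| ≤ R → |F p - F q| ≤ K * |p - q| := by
  obtain ⟨K, hK⟩ := (hF.locallyLipschitzOn (s := Icc (-R) R)).exists_lipschitzOnWith_of_compact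
    isCompact_Icc
  exact ⟨K, K.2, fun p q hp hq => hK.norm_sub_le (abs_le.1 hp) (abs_le.1 hq)⟩

/-- Interior maximum of a continuous function on a time slab that is nonpositive for large `|x|`
and at the two end times. -/
theorem exists_isLocalMax_slab {f : ℝ × ℝ → ℝ} {T X x₁ t₁ : ℝ}
    (hf : ContinuousOn f (univ ×ˢ Ici 0)) (hT : ∀ x, f (x, T) ≤ 0) (h0 : ∀ x, f (x, 0) ≤ 0)
    (hX : ∀ x, ∀ t ∈ Icc 0 T, X ≤ |x| → f (x, t) ≤ 0) (ht₁ : t₁ ∈ Icc 0 T)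
    (hpos : 0 < f (x₁, t₁)) : ∃ x t : ℝ, 0 < t ∧ t < T ∧ IsLocalMax f (x, t) := by
  have hx₁ : |x₁| < X := by
    by_contra! h
    exact (hX x₁ t₁ ht₁ h).not_gt hpos
  have hmem : (x₁, t₁) ∈ Icc (-X) X ×ˢ Icc 0 T := ⟨abs_le.1 hx₁.le, ht₁⟩
  obtain ⟨⟨x, t⟩, ⟨hx, ht⟩, hmax⟩ := (isCompact_Icc.prod isCompact_Icc).exists_isMaxOn
    ⟨_, hmem⟩ (hf.mono (prod_mono (subset_univ _) Icc_subset_Ici_self))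
  have hfx : 0 < f (x, t) := hpos.trans_le (hmax hmem)
  have htT : t ≠ T := by
    rintro rfl
    exact (hT x).not_gt hfx
  have ht0 : t ≠ 0 := by
    rintro rfl
    exact (h0 x).not_gt hfx
  have hxX : |x| < X := by
    by_contra! h
    exact (hX x t ht h).not_gt hfx
  have h₁ : 0 < t := lt_of_le_of_ne ht.1 ht0.symm
  have h₂ : t < T := lt_of_le_of_ne ht.2 htT
  refine ⟨x, t, h₁, h₂, ?_⟩
  filter_upwards [prod_mem_nhds (Icc_mem_nhds (abs_lt.1 hxX).1 (abs_lt.1 hxX).2)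
    (Icc_mem_nhds h₁ h₂)] with z hz using hmax hz

/-- A steep exponential in time: at most `δ` at `t₁` but `N` at `T > t₁`. -/
theorem exists_exp_time_penalty {N δ t₁ T : ℝ} (hδ : 0 < δ) (hT : t₁ < T) :
    ∃ n : ℝ, 0 < n ∧ N * Real.exp (n * (t₁ - T)) < δ := by
  have h : Tendsto (fun n : ℝ => N * Real.exp (n * (t₁ - T))) atTop (𝓝 (N * 0)) :=
    (Real.tendsto_exp_atBot.comp
      (tendsto_id.atTop_mul_const_of_neg (sub_neg.2 hT))).const_mul N
  rw [mul_zero] at h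
  obtain ⟨n, hn, hn'⟩ := ((eventually_gt_atTop 0).and (h.eventually_lt_const hδ)).exists
  exact ⟨n, hn, hn'⟩

theorem hasParabolicDeriv_exp_time (N n T : ℝ) :
    HasParabolicDeriv (fun _ t => N * Real.exp (n * (t - T)))
      (fun _ t => N * (Real.exp (n * (t - T)) * n)) (fun _ _ => 0) (fun _ _ => 0) where
  contDiffOn := by
    have : ContDiff ℝ 2 fun z : ℝ × ℝ => N * Real.exp (n * (z.2 - T)) := by fun_prop
    exact this.contDiffOn
  time x t _ := by
    have := ((((hasDerivAt_id t).sub_const T).const_mul n).exp).const_mul N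
    simpa using this
  space x t _ := hasDerivAt_const _ _
  space_space x t _ := hasDerivAt_const _ _

/-- Comparison of a viscosity subsolution with a classical supersolution of bounded slope, in the
class of functions of linear growth; the nonlinearity is only locally Lipschitz. -/
theorem IsViscositySubsolution.le_of_classical {F : ℝ → ℝ} {ε B : ℝ} {v U Ut Ux Uxx : ℝ → ℝ → ℝ}
    (hF : LocallyLipschitz F) (hε : 0 ≤ ε) (hv : IsViscositySubsolution F ε v)
    (hvc : ContinuousOn (uncurry v) (univ ×ˢ Ici 0))
    (hU : HasParabolicDeriv U Ut Ux Uxx) (hUc : ContinuousOn (uncurry U) (univ ×ˢ Ici 0))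
    (hUF : ∀ x t, 0 < t → ε * Uxx x t ≤ Ut x t + F (Ux x t))
    (hUB : ∀ x t, 0 < t → |Ux x t| ≤ B)
    (hgrowth : ∀ T : ℝ, ∃ C : ℝ, ∀ x : ℝ, ∀ t ∈ Icc 0 T, v x t - U x t ≤ C * (1 + |x|))
    (h0 : ∀ x, v x 0 ≤ U x 0) {x₁ t₁ : ℝ} (ht₁ : 0 ≤ t₁) : v x₁ t₁ ≤ U x₁ t₁ := by
  by_contra! hlt
  set d := v x₁ t₁ - U x₁ t₁ with hd
  have hdpos : 0 < d := sub_pos.2 hlt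
  set T := t₁ + 1 with hT
  obtain ⟨C, hC⟩ := hgrowth T
  -- One more than the growth rate of `v - U`, so that subtracting the barrier leaves a surplus
  -- `-|x|`.
  set M := |C| + 1 with hM
  have hMpos : 0 < M := by positivity
  -- The radius `B + M` covers the slope of `U` with and without the barrier, so a local Lipschitz
  -- constant suffices.
  obtain ⟨K, hK0, hK⟩ := hF.exists_abs_sub_le (B + M)
  -- The growth rate of the barrier in time pays for the Lipschitz error (`K`) and for its own
  -- diffusion (`ε`).
  set L := K + ε with hL
  have hL0 : 0 ≤ L := by positivity
  obtain ⟨k, hkd, hk⟩ : ∃ k, coshBarrier M k L x₁ t₁ < d / 2 ∧ 0 < k :=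
    (((tendsto_coshBarrier x₁ t₁).eventually_lt_const (half_pos hdpos)).and
      self_mem_nhdsWithin).exists
  -- This constant is both the radius beyond which the difference is nonpositive and the size of the
  -- time penalty at `T`, which keeps the maximum away from the final time.
  set N := |C| - M * Real.log (k / 2) with hN
  have hbound : ∀ x, ∀ t ∈ Icc 0 T, v x t - U x t - coshBarrier M k L x t ≤ N - |x| := by
    intro x t ht
    have h₁ := hC x t ht
    have h₂ := le_coshBarrier hMpos.le hk hL0 x ht.1
    have h₃ : C * (1 + |x|) ≤ |C| * (1 + |x|) :=
      mul_le_mul_of_nonneg_right (le_abs_self C) (by positivity)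
    rw [hN]
    rw [mul_add, hM, add_mul] at h₂
    linarith
  have hNpos : 0 < N := by
    have := hbound x₁ t₁ ⟨ht₁, by linarith⟩
    linarith [abs_nonneg x₁]
  obtain ⟨n, hn, hnd⟩ := exists_exp_time_penalty (N := N) (half_pos hdpos) (lt_add_one t₁)
  have hφ := (hU.add (hasParabolicDeriv_coshBarrier (M := M) (L := L) hk)).add
    (hasParabolicDeriv_exp_time N n T)
  obtain ⟨x, t, ht, htT, hmax⟩ := exists_isLocalMax_slab (T := T) (X := N) (x₁ := x₁) (t₁ := t₁)
    (f := fun z => v z.1 z.2 - (U z.1 z.2 + coshBarrier M k L z.1 z.2 +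
      N * Real.exp (n * (z.2 - T))))
    (hvc.sub ((hUc.add (contDiff_coshBarrier hk).continuous.continuousOn).add
      (by fun_prop : Continuous fun z : ℝ × ℝ => N * Real.exp (n * (z.2 - T))).continuousOn))
    (fun x => by
      have := hbound x T ⟨by linarith, le_rfl⟩
      simp only [sub_self, mul_zero, Real.exp_zero, mul_one]
      linarith [abs_nonneg x])
    (fun x => by
      have h₁ := coshBarrier_pos (L := L) hMpos hk x 0
      have h₂ : 0 < N * Real.exp (n * (0 - T)) := by positivity
      have h₃ := h0 x
      dsimp only
      linarith)
    (fun x t ht hx => by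
      have h₁ := hbound x t ht
      have h₂ : 0 < N * Real.exp (n * (t - T)) := by positivity
      dsimp only
      linarith)
    ⟨ht₁, by linarith⟩ (by
      dsimp only
      linarith)
  have key := hv _ hφ.contDiffOn x t ht hmax
  rw [(hφ.time x t ht).deriv, (hφ.space x t ht).deriv, hφ.iteratedDeriv_two x ht] at key
  have hc := Real.cosh_pos x
  have hE := Real.exp_pos (L * t)
  have hD := one_add_mul_exp_mul_cosh_pos (L := L) hk x t
  have hs : |Real.sinh x| ≤ Real.cosh x := by
    rw [abs_le]
    constructor <;> rw [Real.sinh_eq, Real.cosh_eq] <;>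
      linarith [Real.exp_pos x, Real.exp_pos (-x)]
  set q := k * Real.exp (L * t) * Real.cosh x with hq
  have hqpos : 0 < q := by positivity
  -- Up to the factor `M`, the barrier has time derivative `L σ`, slope at most `σ` in absolute
  -- value, and second space derivative at most `σ`.
  set σ := q / (1 + q) with hσ
  have hσ0 : 0 ≤ σ := by positivity
  have hσ1 : σ ≤ 1 := (div_le_one hD).2 (by linarith)
  have e₁ : k * (Real.exp (L * t) * L) * Real.cosh x / (1 + q) = L * σ := by
    rw [hσ, hq]
    ring
  have e₂ : |k * Real.exp (L * t) * Real.sinh x / (1 + q)| ≤ σ := by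
    rw [abs_div, abs_of_pos hD, abs_mul, abs_of_pos (by positivity : 0 < k * Real.exp (L * t))]
    exact div_le_div_of_nonneg_right (mul_le_mul_of_nonneg_left hs (by positivity)) hD.le
  have e₃ : (q * (1 + q) - k * Real.exp (L * t) * Real.sinh x *
      (k * Real.exp (L * t) * Real.sinh x)) / (1 + q) ^ 2 ≤ σ := by
    rw [hσ, div_le_div_iff₀ (by positivity) hD]
    nlinarith [mul_nonneg (mul_self_nonneg (k * Real.exp (L * t) * Real.sinh x)) hD.le]
  rw [e₁] at key
  set s := k * Real.exp (L * t) * Real.sinh x / (1 + q) with hs'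
  have hMs : |M * s| ≤ M * σ := by
    rw [abs_mul, abs_of_pos hMpos]
    exact mul_le_mul_of_nonneg_left e₂ hMpos.le
  have hMσ : M * σ ≤ M := mul_le_of_le_one_right hMpos.le hσ1
  have hb := hUB x t ht
  -- The `0` is the space derivative of the time penalty, kept to match the slope of the full test
  -- function.
  have hlip := hK (Ux x t + M * s + 0) (Ux x t)
    (by rw [add_zero]; exact (abs_add_le _ _).trans (by linarith)) (by linarith)
  rw [show Ux x t + M * s + 0 - Ux x t = M * s by ring] at hlip
  have h₁ := (abs_le.1 hlip).1
  have h₂ : K * |M * s| ≤ K * (M * σ) := mul_le_mul_of_nonneg_left hMs hK0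
  have h₃ := hUF x t ht
  have h₄ := mul_le_mul_of_nonneg_left (mul_le_mul_of_nonneg_left e₃ hMpos.le) hε
  -- All other terms balance; the strictly positive time derivative of the penalty yields the
  -- contradiction.
  have h₅ : 0 < N * (Real.exp (n * (t - T)) * n) := by positivity
  rw [hL] at key
  linarith [mul_add ε (Uxx x t) (M * ((q * (1 + q) - k * Real.exp (L * t) * Real.sinh x *
      (k * Real.exp (L * t) * Real.sinh x)) / (1 + q) ^ 2))]

/-- A viscosity solution stays as close to a classical solution of bounded slope as it is
initially. -/
theorem IsViscositySolution.sub_mem_Icc_of_classical {F g : ℝ → ℝ} {ε B c₁ c₂ : ℝ}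
    {v U Ut Ux Uxx : ℝ → ℝ → ℝ} (hF : LocallyLipschitz F) (hε : 0 ≤ ε)
    (hv : IsViscositySolution F g ε v)
    (hU : HasParabolicDeriv U Ut Ux Uxx) (hUc : ContinuousOn (uncurry U) (univ ×ˢ Ici 0))
    (hUF : ∀ x t, 0 < t → Ut x t + F (Ux x t) = ε * Uxx x t)
    (hUB : ∀ x t, 0 < t → |Ux x t| ≤ B)
    (hUg : ∀ T : ℝ, ∃ C : ℝ, ∀ x : ℝ, ∀ t ∈ Icc 0 T, |U x t| ≤ C * (1 + |x|))
    (h0 : ∀ x, g x - U x 0 ∈ Icc c₁ c₂) (x : ℝ) {t : ℝ} (ht : 0 ≤ t) :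
    v x t - U x t ∈ Icc c₁ c₂ := by
  have hg : ∀ T : ℝ, ∃ C : ℝ, ∀ x : ℝ, ∀ t ∈ Icc 0 T, |v x t - U x t| ≤ C * (1 + |x|) := by
    intro T
    obtain ⟨C, hC⟩ := hv.linear_growth T
    obtain ⟨D, hD⟩ := hUg T
    refine ⟨C + D, fun x t ht => ?_⟩
    rw [add_mul]
    exact (abs_sub _ _).trans (add_le_add (hC x t ht) (hD x t ht))
  have hle : ∀ A c x : ℝ, A * (1 + |x|) + |c| ≤ (A + |c|) * (1 + |x|) := by
    intro A c x
    nlinarith [mul_nonneg (abs_nonneg c) (abs_nonneg x)]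
  constructor
  -- The lower bound is the upper bound for `-v`, which is a subsolution for the nonlinearity
  -- `-F(-p)`.
  · have hF' : LocallyLipschitz fun p => -F (-p) := by
      have := (LipschitzWith.id (α := ℝ)).neg.locallyLipschitz
      exact this.comp (hF.comp this)
    have := hv.supersolution.neg.le_of_classical (B := B) (x₁ := x) hF' hε hv.continuousOn.neg
      (hU.neg.add_const (-c₁))
      (hUc.neg.add continuousOn_const) (fun x t ht => by
        rw [neg_neg]
        linarith [hUF x t ht]) (fun x t ht => by
        rw [abs_neg]
        exact hUB x t ht) (fun T => by
        obtain ⟨C, hC⟩ := hg T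
        refine ⟨C + |c₁|, fun x t ht => le_trans ?_ (hle C c₁ x)⟩
        linarith [(abs_le.1 (hC x t ht)).1, le_abs_self c₁]) (fun x => by
        rw [hv.initial]
        linarith [(h0 x).1]) ht
    linarith
  · have := hv.subsolution.le_of_classical (B := B) (x₁ := x) hF hε hv.continuousOn
      (hU.add_const c₂)
      (hUc.add continuousOn_const) (fun x t ht => (hUF x t ht).ge) hUB (fun T => by
        obtain ⟨C, hC⟩ := hg T
        refine ⟨C + |c₂|, fun x t ht => le_trans ?_ (hle C c₂ x)⟩
        linarith [(abs_le.1 (hC x t ht)).2, neg_abs_le c₂]) (fun x => by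
        rw [hv.initial]
        linarith [(h0 x).2]) ht
    linarith

/-- A classical solution of bounded slope and linear growth is the viscosity solution. -/
theorem HasParabolicDeriv.isTheViscositySolution {F g : ℝ → ℝ} {ε B : ℝ}
    {U Ut Ux Uxx : ℝ → ℝ → ℝ} (hF : LocallyLipschitz F) (hε : 0 ≤ ε)
    (hU : HasParabolicDeriv U Ut Ux Uxx) (hUc : ContinuousOn (uncurry U) (univ ×ˢ Ici 0))
    (hUF : ∀ x t, 0 < t → Ut x t + F (Ux x t) = ε * Uxx x t)
    (hUB : ∀ x t, 0 < t → |Ux x t| ≤ B)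
    (hUg : ∀ T : ℝ, ∃ C : ℝ, ∀ x : ℝ, ∀ t ∈ Icc 0 T, |U x t| ≤ C * (1 + |x|))
    (h0 : ∀ x, U x 0 = g x) : IsTheViscositySolution F g ε U := by
  refine ⟨⟨hUc, hUg, h0, hU.isViscositySubsolution hε fun x t ht => (hUF x t ht).le,
    hU.isViscositySupersolution hε fun x t ht => (hUF x t ht).ge⟩, fun v hv x t ht => ?_⟩
  have := hv.sub_mem_Icc_of_classical (c₁ := 0) (c₂ := 0) hF hε hU hUc hUF hUB hUg
    (fun x => by simp [h0]) x ht
  linarith [this.1, this.2]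

/-! ### Gaussian mollification of the absolute value -/

/-- The primitive of `exp (-s²)` vanishing at `0`. -/
noncomputable def gaussPrimitive (s : ℝ) : ℝ := ∫ r in (0 : ℝ)..s, Real.exp (-r ^ 2)

theorem hasDerivAt_gaussPrimitive (s : ℝ) :
    HasDerivAt gaussPrimitive (Real.exp (-s ^ 2)) s := by
  have h : Continuous fun r : ℝ => Real.exp (-r ^ 2) := by fun_prop
  exact intervalIntegral.integral_hasDerivAt_right (h.intervalIntegrable _ _)
    (h.stronglyMeasurableAtFilter _ _) h.continuousAt

theorem contDiff_gaussPrimitive : ContDiff ℝ 2 gaussPrimitive := by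
  refine (contDiff_succ_iff_deriv (n := 1)).2
    ⟨fun s => (hasDerivAt_gaussPrimitive s).differentiableAt, by simp, ?_⟩
  rw [show deriv gaussPrimitive = fun s => Real.exp (-s ^ 2) from
    funext fun s => (hasDerivAt_gaussPrimitive s).deriv]
  fun_prop

theorem gaussPrimitive_neg (s : ℝ) : gaussPrimitive (-s) = -gaussPrimitive s := by
  have h := intervalIntegral.integral_comp_neg (a := 0) (b := s)
    (fun r : ℝ => Real.exp (-r ^ 2))
  simp only [neg_sq, neg_zero] at h
  rw [gaussPrimitive, gaussPrimitive, h, intervalIntegral.integral_symm]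

theorem monotone_gaussPrimitive : Monotone gaussPrimitive :=
  monotone_of_deriv_nonneg (fun s => (hasDerivAt_gaussPrimitive s).differentiableAt) fun s => by
    rw [(hasDerivAt_gaussPrimitive s).deriv]
    positivity

theorem tendsto_two_mul_gaussPrimitive :
    Tendsto (fun s => 2 * gaussPrimitive s) atTop (𝓝 √Real.pi) := by
  have hint : MeasureTheory.IntegrableOn (fun r : ℝ => Real.exp (-r ^ 2)) (Ioi 0) := by
    simpa using (integrable_exp_neg_mul_sq one_pos).integrableOn
  have h := (MeasureTheory.intervalIntegral_tendsto_integral_Ioi 0 hint tendsto_id).const_mul 2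
  have hg := integral_gaussian_Ioi 1
  simp only [neg_mul, one_mul, div_one] at hg
  rw [hg, mul_div_cancel₀ _ two_ne_zero] at h
  exact h

theorem two_mul_gaussPrimitive_le (s : ℝ) : 2 * gaussPrimitive s ≤ √Real.pi :=
  (monotone_gaussPrimitive.const_mul two_pos.le).ge_of_tendsto tendsto_two_mul_gaussPrimitive s

theorem abs_two_mul_gaussPrimitive_le (s : ℝ) : |2 * gaussPrimitive s| ≤ √Real.pi := by
  have := two_mul_gaussPrimitive_le (-s)
  rw [gaussPrimitive_neg] at this
  exact abs_le.2 ⟨by linarith, two_mul_gaussPrimitive_le s⟩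

/-- The Gaussian mollification `∫ |s + r| exp (-r²) dr` of the absolute value, in closed form. -/
noncomputable def mollifiedAbs (s : ℝ) : ℝ := 2 * s * gaussPrimitive s + Real.exp (-s ^ 2)

theorem hasDerivAt_mollifiedAbs (s : ℝ) :
    HasDerivAt mollifiedAbs (2 * gaussPrimitive s) s := by
  have h₁ := ((hasDerivAt_id s).const_mul 2).mul (hasDerivAt_gaussPrimitive s)
  have h₂ := ((hasDerivAt_pow 2 s).neg).exp
  refine (h₁.add h₂).congr_deriv ?_
  simp
  ring

theorem contDiff_mollifiedAbs : ContDiff ℝ 2 mollifiedAbs := by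
  have := contDiff_gaussPrimitive
  unfold mollifiedAbs
  fun_prop

theorem mollifiedAbs_neg (s : ℝ) : mollifiedAbs (-s) = mollifiedAbs s := by
  rw [mollifiedAbs, mollifiedAbs, gaussPrimitive_neg, neg_sq]
  ring

theorem mollifiedAbs_zero : mollifiedAbs 0 = 1 := by simp [mollifiedAbs]

theorem mollifiedAbs_le (s : ℝ) : mollifiedAbs s ≤ √Real.pi * |s| + 1 := by
  have h₁ := abs_two_mul_gaussPrimitive_le s
  have h₂ : Real.exp (-s ^ 2) ≤ 1 := Real.exp_le_one_iff.2 (by nlinarith [sq_nonneg s])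
  have h₃ : 2 * s * gaussPrimitive s ≤ √Real.pi * |s| :=
    calc 2 * s * gaussPrimitive s = (2 * gaussPrimitive s) * s := by ring
      _ ≤ |(2 * gaussPrimitive s) * s| := le_abs_self _
      _ = |2 * gaussPrimitive s| * |s| := abs_mul _ _
      _ ≤ √Real.pi * |s| := mul_le_mul_of_nonneg_right h₁ (abs_nonneg s)
  rw [mollifiedAbs]
  linarith

/-- Averaging a convex function against an even kernel cannot decrease it; the total mass of the
kernel is `√π`. -/
theorem le_mollifiedAbs (s : ℝ) : √Real.pi * |s| ≤ mollifiedAbs s := by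
  suffices h : ∀ s : ℝ, 0 < s → √Real.pi * s ≤ mollifiedAbs s by
    rcases lt_trichotomy s 0 with hs | rfl | hs
    · rw [abs_of_neg hs, ← mollifiedAbs_neg]
      exact h _ (neg_pos.2 hs)
    · simp [mollifiedAbs_zero]
    · rw [abs_of_pos hs]
      exact h s hs
  -- the Mills ratio estimate, as monotonicity of `2 E s + exp (-s²) / s`
  have hd : ∀ s : ℝ, 0 < s → HasDerivAt (fun s => 2 * gaussPrimitive s + Real.exp (-s ^ 2) / s)
      (-(Real.exp (-s ^ 2) / s ^ 2)) s := by
    intro s hs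
    have h₁ := ((hasDerivAt_pow 2 s).fun_neg).exp.div (hasDerivAt_id s) hs.ne'
    refine (((hasDerivAt_gaussPrimitive s).const_mul 2).add h₁).congr_deriv ?_
    simp only [id]
    field_simp
    ring
  have hanti : AntitoneOn (fun s => 2 * gaussPrimitive s + Real.exp (-s ^ 2) / s) (Ioi 0) := by
    refine antitoneOn_of_deriv_nonpos (convex_Ioi 0)
      (fun s hs => (hd s hs).continuousAt.continuousWithinAt) ?_ ?_
    · rw [interior_Ioi]
      exact fun s hs => (hd s hs).differentiableAt.differentiableWithinAt
    · rw [interior_Ioi]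
      intro s hs
      rw [(hd s hs).deriv]
      exact neg_nonpos.2 (by positivity)
  intro s hs
  -- A decreasing function stays above its limit at infinity, here `√π`; the Mills term is
  -- nonnegative, so only the limit of `2 * gaussPrimitive` is needed.
  have hlim : √Real.pi ≤ 2 * gaussPrimitive s + Real.exp (-s ^ 2) / s := by
    refine le_of_tendsto tendsto_two_mul_gaussPrimitive ?_
    filter_upwards [eventually_ge_atTop s] with r hr
    have h₁ := hanti hs (hs.trans_le hr) hr
    have h₂ : 0 ≤ Real.exp (-r ^ 2) / r := div_nonneg (Real.exp_pos _).le (hs.le.trans hr)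
    dsimp only at h₁
    linarith
  have h := mul_le_mul_of_nonneg_right hlim hs.le
  rw [add_mul, div_mul_cancel₀ _ hs.ne'] at h
  rw [mollifiedAbs]
  linarith

/-- The absolute value mollified at scale `r`: `π^(-1/2) ∫ |y + r z| exp (-z²) dz`. -/
noncomputable def gaussAbs (r y : ℝ) : ℝ :=
  if r = 0 then |y| else r * mollifiedAbs (y / r) / √Real.pi

theorem gaussAbs_zero (y : ℝ) : gaussAbs 0 y = |y| := if_pos rfl

theorem gaussAbs_of_pos {r : ℝ} (hr : 0 < r) (y : ℝ) :
    gaussAbs r y = r * mollifiedAbs (y / r) / √Real.pi := if_neg hr.ne'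

/-- Rescaling the two bounds on `mollifiedAbs`, with `1 ≤ √π` for the upper one. This uniform
estimate gives continuity at scale `0` and the approximation of the sharp kink. -/
theorem gaussAbs_sub_abs_mem_Icc {r : ℝ} (hr : 0 ≤ r) (y : ℝ) :
    gaussAbs r y - |y| ∈ Icc 0 r := by
  rcases hr.eq_or_lt with rfl | hr
  · simp [gaussAbs_zero]
  have hpi : 0 < √Real.pi := Real.sqrt_pos.2 Real.pi_pos
  have h1 : 1 ≤ √Real.pi := Real.one_le_sqrt.2 (by linarith [Real.pi_gt_three])
  have h₁ := le_mollifiedAbs (y / r)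
  have h₂ := mollifiedAbs_le (y / r)
  rw [abs_div, abs_of_pos hr] at h₁ h₂
  have e : r * (√Real.pi * (|y| / r)) = √Real.pi * |y| := by field_simp
  have h₃ := mul_le_mul_of_nonneg_left h₁ hr.le
  have h₄ := mul_le_mul_of_nonneg_left h₂ hr.le
  rw [mul_add, e] at h₄
  rw [e] at h₃
  have h₅ := mul_le_mul_of_nonneg_left h1 hr.le
  rw [gaussAbs_of_pos hr]
  constructor
  · rw [sub_nonneg, le_div_iff₀ hpi]
    linarith
  · rw [sub_le_iff_le_add, div_le_iff₀ hpi]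
    linarith

theorem continuousOn_gaussAbs : ContinuousOn (uncurry gaussAbs) (Ici 0 ×ˢ univ) := by
  rintro ⟨r, y⟩ ⟨hr, -⟩
  rcases (mem_Ici.1 hr).eq_or_lt with rfl | hr
  · have h : Tendsto (fun z : ℝ × ℝ => uncurry gaussAbs z - |z.2|)
        (𝓝[Ici 0 ×ˢ univ] (0, y)) (𝓝 0) := by
      refine tendsto_of_tendsto_of_tendsto_of_le_of_le' tendsto_const_nhds
        (((continuous_fst (X := ℝ) (Y := ℝ)).tendsto (0, y)).mono_left nhdsWithin_le_nhds) ?_ ?_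
      · filter_upwards [self_mem_nhdsWithin] with z hz
        exact (gaussAbs_sub_abs_mem_Icc hz.1 z.2).1
      · filter_upwards [self_mem_nhdsWithin] with z hz
        exact (gaussAbs_sub_abs_mem_Icc hz.1 z.2).2
    have h' : Tendsto (fun z : ℝ × ℝ => |z.2|) (𝓝[Ici 0 ×ˢ univ] (0, y)) (𝓝 |y|) :=
      ((by fun_prop : Continuous fun z : ℝ × ℝ => |z.2|).tendsto (0, y)).mono_left
        nhdsWithin_le_nhds
    have := h.add h'
    simp only [sub_add_cancel, zero_add] at this
    rw [ContinuousWithinAt, uncurry_apply_pair, gaussAbs_zero]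
    exact this
  · have h : ContinuousAt (fun z : ℝ × ℝ => z.1 * mollifiedAbs (z.2 / z.1) / √Real.pi) (r, y) := by
      have h₁ : ContinuousAt (fun z : ℝ × ℝ => z.2 / z.1) (r, y) :=
        continuousAt_snd.div continuousAt_fst hr.ne'
      have h₂ : ContinuousAt (fun z : ℝ × ℝ => mollifiedAbs (z.2 / z.1)) (r, y) :=
        ContinuousAt.comp (contDiff_mollifiedAbs.continuous.continuousAt) h₁
      exact (continuousAt_fst.mul h₂).div_const _
    refine (h.congr ?_).continuousWithinAt
    filter_upwards [continuousAt_fst.eventually (lt_mem_nhds hr)] with z hz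
    exact (gaussAbs_of_pos hz z.2).symm

theorem contDiffOn_gaussAbs : ContDiffOn ℝ 2 (uncurry gaussAbs) (Ioi 0 ×ˢ univ) := by
  have h : ContDiffOn ℝ 2 (fun z : ℝ × ℝ => z.1 * mollifiedAbs (z.2 / z.1) / √Real.pi)
      (Ioi 0 ×ˢ univ) :=
    (contDiffOn_fst.mul (contDiff_mollifiedAbs.comp_contDiffOn
      (contDiffOn_snd.div contDiffOn_fst fun z hz => (ne_of_gt hz.1)))).div_const _
  exact h.congr fun z hz => gaussAbs_of_pos hz.1 z.2

/-- Derivative of `gaussAbs` along a curve. -/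
theorem hasDerivAt_gaussAbs_comp {r y : ℝ → ℝ} {r' y' s : ℝ} (hr : HasDerivAt r r' s)
    (hy : HasDerivAt y y' s) (hpos : 0 < r s) :
    HasDerivAt (fun s => gaussAbs (r s) (y s))
      ((r' * Real.exp (-(y s / r s) ^ 2) + y' * (2 * gaussPrimitive (y s / r s))) / √Real.pi)
      s := by
  have h₁ := (hr.mul ((hasDerivAt_mollifiedAbs (y s / r s)).comp s
    (hy.div hr hpos.ne'))).div_const √Real.pi
  have h₂ : (fun s => gaussAbs (r s) (y s)) =ᶠ[𝓝 s]
      fun s => r s * mollifiedAbs (y s / r s) / √Real.pi := by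
    filter_upwards [hr.continuousAt.eventually (lt_mem_nhds hpos)] with s hs
    exact gaussAbs_of_pos hs _
  refine (h₁.congr_of_eventuallyEq h₂).congr_deriv ?_
  have hne := hpos.ne'
  simp only [comp_apply, Pi.div_apply, mollifiedAbs]
  congr 1
  field_simp
  ring

/-! ### Mollified travelling kinks -/

/-- A kink travelling with speed `α` on top of the plane `p x + m t`, mollified at the parabolic
scale `√(4 ε t + κ²)`. -/
noncomputable def travellingKink (α p m d ε κ x t : ℝ) : ℝ :=
  p * x + m * t + d * gaussAbs √(4 * ε * t + κ ^ 2) (x - α * t + α)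

section travellingKink

variable {α p m d ε κ : ℝ}

theorem continuousOn_travellingKink :
    ContinuousOn (uncurry (travellingKink α p m d ε κ)) (univ ×ˢ Ici 0) := by
  have h : ContinuousOn
      (fun z : ℝ × ℝ => uncurry gaussAbs (√(4 * ε * z.2 + κ ^ 2), z.1 - α * z.2 + α)) univ :=
    continuousOn_gaussAbs.comp
      (by fun_prop : Continuous fun z : ℝ × ℝ =>
        (√(4 * ε * z.2 + κ ^ 2), z.1 - α * z.2 + α)).continuousOn
      fun z _ => ⟨Real.sqrt_nonneg _, mem_univ _⟩
  have h' : ContinuousOn (fun z : ℝ × ℝ => p * z.1 + m * z.2) univ := by fun_prop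
  exact (h'.add (continuousOn_const.mul h)).mono (subset_univ _)

theorem travellingKink_growth (hε : 0 ≤ ε) (T : ℝ) :
    ∃ C : ℝ, ∀ x : ℝ, ∀ t ∈ Icc 0 T, |travellingKink α p m d ε κ x t| ≤ C * (1 + |x|) := by
  refine ⟨|p| + |m| * T + |d| * (√(4 * ε * T + κ ^ 2) + 1 + |α| * T + |α|), fun x t ht => ?_⟩
  have hT : 0 ≤ T := ht.1.trans ht.2
  have hs := Real.sqrt_nonneg (4 * ε * T + κ ^ 2)
  have h₁ := gaussAbs_sub_abs_mem_Icc (Real.sqrt_nonneg (4 * ε * t + κ ^ 2)) (x - α * t + α)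
  have h₂ : √(4 * ε * t + κ ^ 2) ≤ √(4 * ε * T + κ ^ 2) := by
    have := ht.2
    gcongr
  have h₃ : |x - α * t + α| ≤ |x| + |α| * T + |α| := by
    refine (abs_add_le _ _).trans (add_le_add_left ((abs_sub _ _).trans ?_) _)
    rw [abs_mul, abs_of_nonneg ht.1]
    have := ht.2
    gcongr
  have h₄ : |gaussAbs √(4 * ε * t + κ ^ 2) (x - α * t + α)| ≤
      √(4 * ε * T + κ ^ 2) + |x| + |α| * T + |α| := by
    rw [abs_of_nonneg (by linarith [h₁.1, abs_nonneg (x - α * t + α)])]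
    linarith [h₁.2]
  have h₅ : |m| * t ≤ |m| * T := mul_le_mul_of_nonneg_left ht.2 (abs_nonneg m)
  have hx := abs_nonneg x
  calc |travellingKink α p m d ε κ x t|
      ≤ |p| * |x| + |m| * t + |d| * |gaussAbs √(4 * ε * t + κ ^ 2) (x - α * t + α)| := by
        refine (abs_add_le _ _).trans (add_le_add ((abs_add_le _ _).trans ?_) (abs_mul _ _).le)
        rw [abs_mul, abs_mul, abs_of_nonneg ht.1]
    _ ≤ |p| * (1 + |x|) + |m| * T * (1 + |x|) +
        |d| * ((√(4 * ε * T + κ ^ 2) + 1 + |α| * T + |α|) * (1 + |x|)) := by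
        refine add_le_add (add_le_add ?_ ?_) (mul_le_mul_of_nonneg_left (h₄.trans ?_)
          (abs_nonneg d))
        · exact mul_le_mul_of_nonneg_left (by linarith) (abs_nonneg p)
        · nlinarith [mul_nonneg (mul_nonneg (abs_nonneg m) hT) hx]
        · nlinarith [mul_nonneg (mul_nonneg (abs_nonneg α) hT) hx, mul_nonneg (abs_nonneg α) hx,
            mul_nonneg hs hx]
    _ = _ := by ring

theorem hasParabolicDeriv_travellingKink
    (hpos : ∀ t : ℝ, 0 < t → 0 < 4 * ε * t + κ ^ 2) :
    HasParabolicDeriv (travellingKink α p m d ε κ)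
      (fun x t => m + d * ((4 * ε / (2 * √(4 * ε * t + κ ^ 2)) *
        Real.exp (-((x - α * t + α) / √(4 * ε * t + κ ^ 2)) ^ 2) + -α *
          (2 * gaussPrimitive ((x - α * t + α) / √(4 * ε * t + κ ^ 2)))) / √Real.pi))
      (fun x t => p + d * (2 * gaussPrimitive ((x - α * t + α) / √(4 * ε * t + κ ^ 2)) /
        √Real.pi))
      (fun x t => d * (2 * (Real.exp (-((x - α * t + α) / √(4 * ε * t + κ ^ 2)) ^ 2) *
        (1 / √(4 * ε * t + κ ^ 2))) / √Real.pi)) where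
  contDiffOn := by
    have hr : ContDiffOn ℝ 2 (fun z : ℝ × ℝ => √(4 * ε * z.2 + κ ^ 2)) (univ ×ˢ Ioi 0) :=
      ContDiffOn.sqrt (by fun_prop) fun z hz => (hpos z.2 hz.2).ne'
    have h : ContDiffOn ℝ 2
        (fun z : ℝ × ℝ => uncurry gaussAbs (√(4 * ε * z.2 + κ ^ 2), z.1 - α * z.2 + α))
        (univ ×ˢ Ioi 0) :=
      contDiffOn_gaussAbs.comp (hr.prodMk (by fun_prop))
        fun z hz => ⟨Real.sqrt_pos.2 (hpos z.2 hz.2), mem_univ _⟩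
    have h' : ContDiffOn ℝ 2 (fun z : ℝ × ℝ => p * z.1 + m * z.2) (univ ×ˢ Ioi 0) := by fun_prop
    exact h'.add (contDiffOn_const.mul h)
  time x t ht := by
    have hr : HasDerivAt (fun t => √(4 * ε * t + κ ^ 2))
        (4 * ε / (2 * √(4 * ε * t + κ ^ 2))) t := by
      have := (((hasDerivAt_id t).const_mul (4 * ε)).add_const (κ ^ 2)).sqrt (hpos t ht).ne'
      simpa using this
    have hy : HasDerivAt (fun t => x - α * t + α) (-α) t := by
      simpa using (((hasDerivAt_id t).const_mul α).const_sub x).add_const α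
    have hl : HasDerivAt (fun t => p * x + m * t) m t := by
      simpa using ((hasDerivAt_id t).const_mul m).const_add (p * x)
    exact hl.add ((hasDerivAt_gaussAbs_comp hr hy (Real.sqrt_pos.2 (hpos t ht))).const_mul d)
  space x t ht := by
    have hy : HasDerivAt (fun x => x - α * t + α) 1 x :=
      ((hasDerivAt_id x).sub_const _).add_const _
    have hl : HasDerivAt (fun x => p * x + m * t) p x := by
      simpa using ((hasDerivAt_id x).const_mul p).add_const (m * t)
    refine (hl.add ((hasDerivAt_gaussAbs_comp (hasDerivAt_const x √(4 * ε * t + κ ^ 2)) hy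
      (Real.sqrt_pos.2 (hpos t ht))).const_mul d)).congr_deriv ?_
    simp
  space_space x t ht := by
    have hy : HasDerivAt (fun x => (x - α * t + α) / √(4 * ε * t + κ ^ 2))
        (1 / √(4 * ε * t + κ ^ 2)) x :=
      (((hasDerivAt_id x).sub_const _).add_const _).div_const _
    exact (((((hasDerivAt_gaussPrimitive _).comp x hy).const_mul 2).div_const _).const_mul
      d).const_add p

/-- This keeps the slope of the mollified kink in `[p - d, p + d]`, where `F` is affine. -/
theorem abs_slope_gauss_le (hd : 0 ≤ d) (s : ℝ) :
    |d * (2 * gaussPrimitive s / √Real.pi)| ≤ d := by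
  have hpi : 0 < √Real.pi := Real.sqrt_pos.2 Real.pi_pos
  rw [abs_mul, abs_of_nonneg hd, abs_div, abs_of_pos hpi]
  exact mul_le_of_le_one_right hd ((div_le_one hpi).2 (abs_two_mul_gaussPrimitive_le s))

/-- If `F` is affine on `[p - d, p + d]` and the kink travels with the slope of `F` there, then the
mollified kink is a classical solution of bounded slope. -/
theorem travellingKink_classical {F : ℝ → ℝ} {β : ℝ} (hd : 0 ≤ d)
    (hpos : ∀ t : ℝ, 0 < t → 0 < 4 * ε * t + κ ^ 2)
    (hlin : ∀ q, |q - p| ≤ d → F q = α * q + β) :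
    ∃ Ut Ux Uxx : ℝ → ℝ → ℝ,
      HasParabolicDeriv (travellingKink α p (-(α * p + β)) d ε κ) Ut Ux Uxx ∧
      (∀ x t, 0 < t → Ut x t + F (Ux x t) = ε * Uxx x t) ∧
      ∀ x t, 0 < t → |Ux x t| ≤ |p| + d := by
  refine ⟨_, _, _, hasParabolicDeriv_travellingKink hpos, fun x t ht => ?_, fun x t ht =>
    (abs_add_le _ _).trans (add_le_add_right (abs_slope_gauss_le hd _) _)⟩
  rw [hlin _ (by rw [add_sub_cancel_left]; exact abs_slope_gauss_le hd _)]
  have hr := (Real.sqrt_pos.2 (hpos t ht)).ne'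
  have hpi : √Real.pi ≠ 0 := (Real.sqrt_pos.2 Real.pi_pos).ne'
  -- The transport terms cancel against the affine `F`. What remains is the heat equation for the
  -- profile: the scale `r = √(4 ε t + κ²)` satisfies `r' = 2 ε / r`.
  field_simp
  ring

/-! ### The sharp kink as a viscosity solution -/

/-- Difference quotients from the right are at least `-d`, those from the left at most `d`, and both
converge to `c`. -/
theorem abs_deriv_le_of_local_lower_bound {φ : ℝ → ℝ} {c x : ℝ} (hφ : HasDerivAt φ c x)
    (h : ∀ᶠ y in 𝓝 x, -(d * |y - x|) ≤ φ y - φ x) : |c| ≤ d := by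
  rw [hasDerivAt_iff_tendsto_slope] at hφ
  rw [abs_le]
  constructor
  · have hsub : Ioi x ⊆ {x}ᶜ := fun y hy => ne_of_gt hy
    refine ge_of_tendsto (hφ.mono_left (nhdsWithin_mono x hsub)) ?_
    filter_upwards [nhdsWithin_le_nhds h, self_mem_nhdsWithin] with y hy hxy
    have hxy : 0 < y - x := sub_pos.2 hxy
    rw [abs_of_pos hxy] at hy
    rw [slope_def_field, le_div_iff₀ hxy]
    linarith
  · have hsub : Iio x ⊆ {x}ᶜ := fun y hy => ne_of_lt hy
    refine le_of_tendsto (hφ.mono_left (nhdsWithin_mono x hsub)) ?_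
    filter_upwards [nhdsWithin_le_nhds h, self_mem_nhdsWithin] with y hy hxy
    have hxy : y - x < 0 := sub_neg.2 hxy
    rw [abs_of_neg hxy] at hy
    rw [slope_def_field, div_le_iff_of_neg hxy]
    linarith

/-- The sharp kink satisfies the first order equation at touching test functions, since it is
affine along characteristics and has slopes in the interval where `F` is affine. -/
theorem travellingKink_test_eq {F : ℝ → ℝ} {β : ℝ} (hd : 0 ≤ d)
    (hlin : ∀ q, |q - p| ≤ d → F q = α * q + β) {φ : ℝ → ℝ → ℝ}
    (hφ : ContDiffOn ℝ 2 (uncurry φ) (univ ×ˢ Ioi 0)) {x t : ℝ} (ht : 0 < t)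
    (hext : IsLocalExtr
      (fun z : ℝ × ℝ => travellingKink α p (-(α * p + β)) d 0 0 z.1 z.2 - φ z.1 z.2) (x, t)) :
    deriv (fun s => φ x s) t + F (deriv (fun y => φ y t) x) = 0 := by
  have hform : ∀ x t, travellingKink α p (-(α * p + β)) d 0 0 x t =
      p * x + -(α * p + β) * t + d * |x - α * t + α| := by
    intro x t
    simp [travellingKink, gaussAbs_zero]
  simp only [hform] at hext
  have hnhds : (univ ×ˢ Ioi 0 : Set (ℝ × ℝ)) ∈ 𝓝 (x, t) :=
    prod_mem_nhds univ_mem (Ioi_mem_nhds ht)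
  have hD := ((hφ.differentiableOn two_ne_zero).differentiableAt hnhds).hasFDerivAt
  set f' := fderiv ℝ (uncurry φ) (x, t)
  have hx : HasDerivAt (fun y => φ y t) (f' (1, 0)) x :=
    hD.comp_hasDerivAt (f := fun y : ℝ => (y, t)) x
      ((hasDerivAt_id x).prodMk (hasDerivAt_const x t))
  have hs : HasDerivAt (fun s => φ x s) (f' (0, 1)) t :=
    hD.comp_hasDerivAt (f := fun s : ℝ => (x, s)) t
      ((hasDerivAt_const t x).prodMk (hasDerivAt_id t))
  -- Differentiation along the characteristic of speed `α` through `(x, t)`.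
  have hc : HasDerivAt (fun s => φ (x + α * (s - t)) s) (f' (α, 1)) t := by
    have hl : HasDerivAt (fun s : ℝ => (x + α * (s - t), s)) (α, 1) t := by
      have := (((hasDerivAt_id t).sub_const t).const_mul α).const_add x
      rw [mul_one] at this
      exact this.prodMk (hasDerivAt_id t)
    have hD' : HasFDerivAt (uncurry φ) f' ((fun s : ℝ => (x + α * (s - t), s)) t) := by
      simpa using hD
    exact hD'.comp_hasDerivAt (f := fun s : ℝ => (x + α * (s - t), s)) t hl
  have hf : f' (α, 1) = α * f' (1, 0) + f' (0, 1) := by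
    rw [← smul_eq_mul, ← map_smul, ← map_add]
    simp
  have hslope : |f' (1, 0) - p| ≤ d := by
    have hψ : HasDerivAt (fun y => φ y t - p * y) (f' (1, 0) - p) x := by
      simpa using hx.fun_sub ((hasDerivAt_id x).const_mul p)
    have htri : ∀ y : ℝ, |(|y - α * t + α| - |x - α * t + α|)| ≤ |y - x| := fun y => by
      refine (abs_abs_sub_abs_le _ _).trans_eq ?_
      congr 1
      ring
    have hcont : Tendsto (fun y : ℝ => (y, t)) (𝓝 x) (𝓝 (x, t)) :=
      (by fun_prop : Continuous fun y : ℝ => (y, t)).tendsto x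
    rcases hext with hmin | hmax
    -- A minimum bounds `φ` from above, so the one-sided estimate applies to its negative.
    · rw [← abs_neg]
      refine abs_deriv_le_of_local_lower_bound hψ.neg ?_
      filter_upwards [hcont.eventually hmin] with y hy
      have := mul_le_mul_of_nonneg_left (abs_le.1 (htri y)).2 hd
      simp only [Pi.neg_apply]
      linarith
    · refine abs_deriv_le_of_local_lower_bound hψ ?_
      filter_upwards [hcont.eventually hmax] with y hy
      have := mul_le_mul_of_nonneg_left (abs_le.1 (htri y)).1 hd
      linarith
  -- Along the characteristic the modulus is constant, so the kink is affine there with slope `p α -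
  -- (α p + β) = -β`, and a touching `φ` shares this derivative.
  have hchar : -β - f' (α, 1) = 0 := by
    have hl : HasDerivAt (fun s => p * (x + α * (s - t)) + -(α * p + β) * s +
        d * |x + α * (s - t) - α * s + α|) (-β) t := by
      have h₁ : (fun s => p * (x + α * (s - t)) + -(α * p + β) * s +
          d * |x + α * (s - t) - α * s + α|) =
          fun s => -β * s + (p * (x - α * t) + d * |x - α * t + α|) := by
        funext s
        rw [show x + α * (s - t) - α * s + α = x - α * t + α by ring]
        ring
      rw [h₁]
      simpa using ((hasDerivAt_id t).const_mul (-β)).add_const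
        (p * (x - α * t) + d * |x - α * t + α|)
    have hcurve : Tendsto (fun s : ℝ => (x + α * (s - t), s)) (𝓝 t) (𝓝 (x, t)) := by
      have h := (by fun_prop : Continuous fun s : ℝ => (x + α * (s - t), s)).tendsto t
      simpa using h
    have hext' : IsLocalExtr (fun s => p * (x + α * (s - t)) + -(α * p + β) * s +
        d * |x + α * (s - t) - α * s + α| - φ (x + α * (s - t)) s) t := by
      rcases hext with hmin | hmax
      · left
        filter_upwards [hcurve.eventually hmin] with s hs
        simpa using hs
      · right
        filter_upwards [hcurve.eventually hmax] with s hs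
        simpa using hs
    exact hext'.hasDerivAt_eq_zero (hl.sub hc)
  rw [hx.deriv, hs.deriv, hlin _ hslope]
  linarith

theorem lipschitzWith_kink (hd : 0 ≤ d) :
    LipschitzWith ⟨|p| + d, by positivity⟩ fun x : ℝ => p * x + d * |x + α| := by
  refine LipschitzWith.of_dist_le_mul fun x y => ?_
  rw [Real.dist_eq, Real.dist_eq]
  have h : |(|x + α| - |y + α|)| ≤ |x - y| := by
    refine (abs_abs_sub_abs_le _ _).trans_eq ?_
    congr 1
    ring
  calc |p * x + d * |x + α| - (p * y + d * |y + α|)|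
      = |p * (x - y) + d * (|x + α| - |y + α|)| := by
        congr 1
        ring
    _ ≤ |p| * |x - y| + d * |x - y| := by
        refine (abs_add_le _ _).trans ?_
        rw [abs_mul, abs_mul, abs_of_nonneg hd]
        gcongr
    _ = _ := (add_mul _ _ _).symm

variable {F : ℝ → ℝ} {β : ℝ}

theorem isTheViscositySolution_heatKink (hF : LocallyLipschitz F) (hd : 0 ≤ d) (hε : 0 < ε)
    (hlin : ∀ q, |q - p| ≤ d → F q = α * q + β) :
    IsTheViscositySolution F (fun x => p * x + d * |x + α|) ε
      (travellingKink α p (-(α * p + β)) d ε 0) := by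
  obtain ⟨Ut, Ux, Uxx, hU, hUF, hUB⟩ := travellingKink_classical (ε := ε) (κ := 0) hd
    (fun t ht => by positivity) hlin
  exact hU.isTheViscositySolution hF hε.le continuousOn_travellingKink hUF hUB
    (travellingKink_growth hε.le) fun x => by simp [travellingKink, gaussAbs_zero]

/-- Existence comes from the touching test functions. For uniqueness, any solution is compared with
kinks mollified at a fixed scale `κ`, which are classical for `ε = 0`. -/
theorem isTheViscositySolution_sharpKink (hF : LocallyLipschitz F) (hd : 0 ≤ d)
    (hlin : ∀ q, |q - p| ≤ d → F q = α * q + β) :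
    IsTheViscositySolution F (fun x => p * x + d * |x + α|) 0
      (travellingKink α p (-(α * p + β)) d 0 0) := by
  refine ⟨⟨continuousOn_travellingKink, travellingKink_growth le_rfl, fun x => ?_, ?_, ?_⟩,
    fun v hv x t ht => ?_⟩
  · simp [travellingKink, gaussAbs_zero]
  · intro φ hφ x t ht hmax
    rw [travellingKink_test_eq hd hlin hφ ht (Or.inr hmax), zero_mul]
  · intro φ hφ x t ht hmin
    rw [travellingKink_test_eq hd hlin hφ ht (Or.inl hmin), zero_mul]
  · refine eq_of_abs_sub_nonpos (le_of_forall_pos_le_add fun η hη => ?_)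
    -- Chosen so that `d κ ≤ η / 2`; the `+ 1` allows `d = 0`. The initial and the final replacement
    -- of the sharp kink each cost at most `η / 2`.
    set κ := η / (2 * (d + 1)) with hκ
    have hκpos : 0 < κ := by positivity
    have hdκ : d * κ ≤ η / 2 := by
      rw [hκ, ← div_div, mul_div_assoc', div_le_iff₀ (by positivity)]
      nlinarith
    have hr : ∀ t : ℝ, √(4 * 0 * t + κ ^ 2) = κ := fun t => by
      simp [Real.sqrt_sq hκpos.le]
    have hclose : ∀ x t, travellingKink α p (-(α * p + β)) d 0 0 x t -
        travellingKink α p (-(α * p + β)) d 0 κ x t ∈ Icc (-(η / 2)) 0 := by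
      intro x t
      have h := gaussAbs_sub_abs_mem_Icc hκpos.le (x - α * t + α)
      have h₁ := mul_nonneg hd h.1
      have h₂ := mul_le_mul_of_nonneg_left h.2 hd
      rw [travellingKink, travellingKink, hr]
      simp only [mul_zero, zero_mul, ne_eq, OfNat.ofNat_ne_zero, not_false_eq_true, zero_pow,
        add_zero, Real.sqrt_zero, gaussAbs_zero]
      constructor <;> linarith
    obtain ⟨Ut, Ux, Uxx, hU, hUF, hUB⟩ := travellingKink_classical (ε := 0) (κ := κ) hd
      (fun t ht => by simpa using pow_pos hκpos 2) hlin
    have h := hv.sub_mem_Icc_of_classical (c₁ := -(η / 2)) (c₂ := 0) hF le_rfl hU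
      continuousOn_travellingKink hUF hUB (travellingKink_growth le_rfl)
      (fun x => by simpa [travellingKink, gaussAbs_zero] using hclose x 0) x ht
    have h' := hclose x t
    rw [zero_add, abs_le]
    constructor <;> linarith [h.1, h.2, h'.1, h'.2]

end travellingKink

/-! ### The gap at the apex -/

theorem corollary1p3 (F : ℝ → ℝ) (hF : LocallyLipschitz F) (a b : ℝ) (hab : a < b)
    (hlin : ∃ α β : ℝ, ∀ p ∈ Set.Ioo a b, F p = α * p + β) :
    ∃ g : ℝ → ℝ, (∃ K : NNReal, LipschitzWith K g) ∧
      ∃ u : ℝ → ℝ → ℝ, IsTheViscositySolution F g 0 u ∧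
        ∃ c₀ : ℝ, 0 < c₀ ∧ ∀ ε ∈ Set.Ioo (0 : ℝ) (1 / 4),
          ∃ uε : ℝ → ℝ → ℝ, IsTheViscositySolution F g ε uε ∧
            c₀ * Real.sqrt ε ≤ |uε 0 1 - u 0 1| := by
  obtain ⟨α, β, hαβ⟩ := hlin
  set p := (a + b) / 2 with hp
  -- A quarter of the length, so that the closed interval `[p - d, p + d]` lies inside `(a, b)`.
  set d := (b - a) / 4 with hd
  have hdpos : 0 < d := by linarith
  have hpd : ∀ q, |q - p| ≤ d → F q = α * q + β := fun q hq =>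
    hαβ q ⟨by linarith [(abs_le.1 hq).1], by linarith [(abs_le.1 hq).2]⟩
  refine ⟨fun x => p * x + d * |x + α|, ⟨_, lipschitzWith_kink hdpos.le⟩, _,
    isTheViscositySolution_sharpKink hF hdpos.le hpd, 2 * d / √Real.pi, by positivity,
    fun ε hε => ⟨_, isTheViscositySolution_heatKink hF hdpos.le hε.1 hpd, ?_⟩⟩
  have hs : √(4 * ε * 1 + 0 ^ 2) = 2 * √ε := by
    rw [show 4 * ε * 1 + 0 ^ 2 = 2 ^ 2 * ε by ring, Real.sqrt_mul (by norm_num),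
      Real.sqrt_sq two_pos.le]
  have hεpos := Real.sqrt_pos.2 hε.1
  -- At `(0, 1)` the sharp modulus vanishes, while the mollified one equals its scale `2 √ε` divided
  -- by `√π`.
  have e : travellingKink α p (-(α * p + β)) d ε 0 0 1 -
      travellingKink α p (-(α * p + β)) d 0 0 0 1 = 2 * d / √Real.pi * √ε := by
    rw [travellingKink, travellingKink, hs, gaussAbs_of_pos (by positivity)]
    simp [gaussAbs_zero, mollifiedAbs_zero]
    ring
  rw [e]
  exact le_abs_self _
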